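/- **Conventions.** Let $\mathrm{QSym}\subset\mathbb{Q}[[x_1,x_2,\dots]]$ be the Hopf algebra of quasisymmetric functions, with monomial basis $M_\alpha=\sum_{i_1<\cdots<i_\ell}x_{i_1}^{\alpha_1}\cdots x_{i_\ell}^{\alpha_\ell}$ indexed by all compositions $\alpha=(\alpha_1,\dots,\alpha_\ell)$ (including $\emptyset$), with coproduct $\Delta M_\alpha=\sum_{\beta\cdot\gamma=\alpha}M_\beta\otimes M_\gamma$ ($\beta\cdot\gamma$ is concatenation), and with fundamental basis $F_\alpha=\sum_\beta M_\beta$, summed over all refinements $\beta$ of $\alpha$. For a set $S=\{i_1<\cdots<i_s\}\subseteq\{1,\dots,n-1\}$ let $\mathrm{comp}(S)=(i_1,i_2-i_1,\dots,n-i_s)$, a composition of $n$. The diagram of a composition $\alpha$ has $\alpha_i$ left-justified cells in row $i$, with rows numbered from the bottom. Write $\beta\subseteq\alpha$ if $\ell(\beta)\le\ell(\alpha)$ and $\beta_i\le\alpha_i$ for all $i\le\ell(\beta)$; then $\alpha/\beta$ is the set of cells of $\alpha$ that are not in $\beta$. Fix a set $C$ of columns that contains the first column. For $\beta\subseteq\alpha$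 let $\mathcal{ST}_{\alpha/\beta}$ be the set of fillings of $\alpha/\beta$ by $1,\dots,|\alpha|-|\beta|$, each used exactly once, whose rows increase from left to right and whose columns in $C$ increase from bottom to top; put $\mathcal{ST}_\alpha=\mathcal{ST}_{\alpha/\emptyset}$. Let $\mathrm{Des}(T)$ be one of the following four descent sets: the set of all $i$ such that $i+1$ lies, respectively, (1) in a row strictly above $i$, (2) in a row weakly below $i$, (3) in a row strictly below $i$, (4) in a row weakly above $i$. For each composition $\alpha$ put $$\mathscr{S}_\alpha=\sum_{U\in\mathcal{ST}_\alpha}F_{\mathrm{comp}(\mathrm{Des}(U))}.$$ The skew functions $\mathscr{S}_{\alpha/\beta}\in\mathrm{QSym}$, for $\beta\subseteq\alpha$, are defined implicitly by $$\Delta\mathscr{S}_\alpha=\sum_{\beta\subseteq\alpha}\mathscr{S}_\beta\otimes\mathscr{S}_{\alpha/\beta}.\qquad(*)$$ Call $\beta\subseteq\alpha$ *$C$-justified in $\alpha$* if, whenever a cell in a column of $C$ belongs to $\beta$, every cell of $\alpha$ below it in that column also belongs to $\beta$. **Proposition (combinatorial skew formula).** Let $\alpha$ be a composition. 1. A solution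 of $(*)$ is given by $$\mathscr{S}_{\alpha/\beta}=\sum_{T\in\mathcal{ST}_{\alpha/\beta}}F_{\mathrm{comp}(\mathrm{Des}(T))}$$ if $\beta\subseteq\alpha$ is $C$-justified in $\alpha$, and $\mathscr{S}_{\alpha/\beta}=0$ for all other $\beta\subseteq\alpha$. 2. For descent sets (1) and (2) this is the only solution. For any of the four descent sets, if $\beta\subseteq\alpha$ and $\mathscr{S}_\beta$ is not in the linear span of the $\mathscr{S}_\delta$ with $\delta\subseteq\alpha$, $\delta\ne\beta$, then $\mathscr{S}_{\alpha/\beta}$ has the value in part 1 in every solution of $(*)$. In particular, in all these cases $\mathscr{S}_{\alpha/\beta}\neq0$ only if $\beta$ is $C$-justified in $\alpha$. 3. If $\beta\subseteq\alpha$ is the shape formed by the entries $1,\dots,|\beta|$ of some $U\in\mathcal{ST}_\alpha$, then $\beta$ is $C$-justified in $\alpha$. 4. If every column of $\alpha$ is in $C$, if $\beta\subseteq\alpha$ is $C$-justified in $\alpha$, and if every row of $\alpha/\beta$ contains a cell (that is, $\beta_i<\alpha_i$ for all $i\le\ell(\beta)$), then $\beta$ is a partition. -/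

import Mathlib

open scoped TensorProduct

noncomputable section

namespace QSymSkew

/-! ### Compositions -/

/-- A composition of any size `n ≥ 0`: the pair of `n` and a composition of `n`. -/
abbrev Comp : Type := Σ n : ℕ, Composition n

namespace Comp

/-- The size `|α|`. -/
abbrev size (α : Comp) : ℕ := α.1

/-- The list of parts, all of them positive. -/
abbrev parts (α : Comp) : List ℕ := α.2.blocks

/-- The length `ℓ(α)`. -/
abbrev len (α : Comp) : ℕ := α.parts.length

/-- The `i`-th part, with `i` counted from `0`; it is `0` for `i ≥ ℓ(α)`. -/
def part (α : Comp) (i : ℕ) : ℕ := α.parts.getD i 0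

/-- The composition with a given list of positive parts. -/
def ofList (l : List ℕ) (h : ∀ a ∈ l, 0 < a) : Comp :=
  ⟨l.sum, { blocks := l, blocks_pos := fun {a} ha => h a ha, blocks_sum := rfl }⟩

/-- The empty composition, of size `0`. -/
def empty : Comp := ofList [] (by simp)

/-- The composition made of the first `k` parts. -/
def take (α : Comp) (k : ℕ) : Comp :=
  ofList (α.parts.take k) fun _ ha => α.2.blocks_pos (List.mem_of_mem_take ha)

/-- The composition made of all parts but the first `k`. -/
def drop (α : Comp) (k : ℕ) : Comp :=
  ofList (α.parts.drop k) fun _ ha => α.2.blocks_pos (List.mem_of_mem_drop ha)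

/-- A composition is a partition if its parts weakly decrease. -/
def IsPartition (α : Comp) : Prop := α.parts.Pairwise (· ≥ ·)

/-- `β` refines `α`: the list of parts of `β` can be cut into consecutive pieces
whose sums are, in order, the parts of `α`. -/
def Refines (β α : Comp) : Prop :=
  ∃ L : List (List ℕ), L.flatten = β.parts ∧ L.map List.sum = α.parts

/-- `β ⊆ α`: `ℓ(β) ≤ ℓ(α)` and `βᵢ ≤ αᵢ` for every `i` up to `ℓ(β)`. -/
def Contained (β α : Comp) : Prop :=
  β.len ≤ α.len ∧ ∀ i < β.len, β.part i ≤ α.part i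

open Classical in
/-- The finite set of all compositions `β` with `β ⊆ α` (these have size at most `|α|`). -/
def below (α : Comp) : Finset Comp :=
  ((Finset.range (α.size + 1)).sigma fun _ => Finset.univ).filter fun β => Contained β α

/-- `comp(S) = (i₁, i₂ - i₁, …, n - iₛ)` for a set `S = {i₁ < ⋯ < iₛ}` of integers
strictly between `0` and `n`. -/
def ofSet (n : ℕ) (S : Finset ℕ) : Comp :=
  ⟨n, CompositionAsSet.toComposition
    { boundaries := Finset.univ.filter fun i : Fin (n + 1) =>
        i = 0 ∨ i = Fin.last n ∨ (i : ℕ) ∈ S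
      zero_mem := by simp
      getLast_mem := by simp }⟩

theorem ext_parts {α β : Comp} (h : α.parts = β.parts) : α = β := by
  obtain ⟨n, a⟩ := α
  obtain ⟨m, b⟩ := β
  have hnm : n = m := by
    rw [← a.blocks_sum, ← b.blocks_sum]
    exact congrArg List.sum h
  subst hnm
  exact congrArg (Sigma.mk n) (Composition.ext h)

end Comp

/-! ### Quasisymmetric functions -/

/-- The nonzero exponents of the monomial `x^m`, in increasing order of the variables. -/
def exponents (m : ℕ →₀ ℕ) : List ℕ := (m.support.sort (· ≤ ·)).map m

open Classical in
/-- The monomial quasisymmetric function `∑_{i₁ < ⋯ < iₗ} x_{i₁}^{α₁} ⋯ x_{iₗ}^{αₗ}` as a power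
series: the coefficient of `x^m` is `1` if the nonzero exponents of `x^m` are, in order, the parts
of `α`, and `0` otherwise. -/
def monomialSeries (α : Comp) : MvPowerSeries ℕ ℚ :=
  fun m => if exponents m = α.parts then 1 else 0

/-- The space of quasisymmetric functions in `ℚ[[x₀, x₁, …]]`. -/
def QSym : Submodule ℚ (MvPowerSeries ℕ ℚ) :=
  Submodule.span ℚ (Set.range monomialSeries)

theorem exponents_toFinsupp (α : Comp) :
    exponents (α.parts.toFinsupp) = α.parts := by
  have hs : α.parts.toFinsupp.support = Finset.range α.parts.length := by
    ext i
    simp only [Finsupp.mem_support_iff, List.toFinsupp_apply, Finset.mem_range]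
    constructor
    · intro h
      by_contra hi
      exact h (List.getD_eq_default _ _ (not_lt.mp hi))
    · intro h
      rw [List.getD_eq_getElem _ _ h]
      exact (α.2.blocks_pos (List.getElem_mem h)).ne'
  unfold exponents
  rw [hs]
  apply List.ext_getElem
  · simp
  · intro i h1 h2
    simp [List.getElem?_eq_getElem h2]

theorem linearIndependent_monomialSeries : LinearIndependent ℚ monomialSeries := by
  classical
  rw [linearIndependent_iff']
  intro s g hg α hα
  have hM : ∀ β, MvPowerSeries.coeff α.parts.toFinsupp (monomialSeries β) =
      if α.parts = β.parts then (1 : ℚ) else 0 := fun β => by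
    change monomialSeries β α.parts.toFinsupp = _
    unfold monomialSeries
    rw [exponents_toFinsupp]
  have h := congrArg (MvPowerSeries.coeff α.parts.toFinsupp) hg
  simp only [map_sum, map_smul, hM, map_zero, smul_eq_mul] at h
  rw [Finset.sum_eq_single α] at h
  · simpa using h
  · intro β _ hβ
    have : ¬ α.parts = β.parts := fun e => hβ (Comp.ext_parts e).symm
    simp [this]
  · intro h'
    exact absurd hα h'

/-- The basis of monomial quasisymmetric functions `M_α`. -/
def M : Module.Basis Comp ℚ QSym := Module.Basis.span linearIndependent_monomialSeries

open Classical in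
/-- The fundamental quasisymmetric function: the sum of `M_β` over all refinements `β` of `α`. -/
def F (α : Comp) : QSym :=
  ∑ β : Composition α.size with Comp.Refines ⟨α.size, β⟩ α, M ⟨α.size, β⟩

/-- The coproduct of the Hopf algebra of quasisymmetric functions: the linear map with
`Δ M_α = ∑ M_β ⊗ M_γ` over all pairs `(β, γ)` whose concatenation is `α`. -/
def Δ : QSym →ₗ[ℚ] QSym ⊗[ℚ] QSym :=
  M.constr ℚ fun α => ∑ k ∈ Finset.range (α.len + 1), M (α.take k) ⊗ₜ[ℚ] M (α.drop k)

/-- The family `S` of quasisymmetric functions, indexed by the `β ⊆ α` (other values are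
irrelevant), satisfies the equation `Δ 𝒮_α = ∑_{β ⊆ α} 𝒮_β ⊗ 𝒮_{α/β}` that implicitly
defines the skew functions of the family `Sk`, with `S β` in the place of `𝒮_{α/β}`. -/
def IsSkewFamily (Sk : Comp → QSym) (α : Comp) (S : Comp → QSym) : Prop :=
  Δ (Sk α) = ∑ β ∈ α.below, Sk β ⊗ₜ[ℚ] S β

/-! ### Diagrams and standard tableaux -/

/-- The cells `(i, j)` of the skew diagram `α / β`: row `i` counted from the bottom and column `j`
counted from the left, both from `0`. -/
def cells (α β : Comp) : Finset (ℕ × ℕ) :=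
  (Finset.range α.len ×ˢ Finset.range α.size).filter
    fun c => β.part c.1 ≤ c.2 ∧ c.2 < α.part c.1

/-- A filling of `α / β` in which each of `1, …, |α/β|` appears exactly once. -/
abbrev StdFilling (α β : Comp) : Type :=
  {c // c ∈ cells α β} ≃ {i // i ∈ Finset.Icc 1 (α.size - β.size)}

open Classical in
/-- The standard tableaux of shape `α / β` whose rows increase from left to right and whose
columns with index in `C` increase from bottom to top. -/
def ST (C : Set ℕ) (α β : Comp) : Finset (StdFilling α β) :=
  Finset.univ.filter fun T =>
    (∀ c d, c.1.1 = d.1.1 → c.1.2 < d.1.2 → (T c).1 < (T d).1) ∧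
    (∀ c d, c.1.2 = d.1.2 → c.1.2 ∈ C → c.1.1 < d.1.1 → (T c).1 < (T d).1)

/-- The four notions of descent. -/
inductive DescentKind
  | dualImmaculate
  | rowStrictDualImmaculate
  | advanced
  | advancedBar

/-- Whether `i` is a descent, when `i` is in row `r` and `i + 1` is in row `s` (rows are counted
from the bottom): `i + 1` is strictly above, weakly below, strictly below, or weakly above `i`. -/
def DescentKind.Rel : DescentKind → ℕ → ℕ → Prop
  | dualImmaculate, r, s => r < s
  | rowStrictDualImmaculate, r, s => s ≤ r
  | advanced, r, s => s < r
  | advancedBar, r, s => r ≤ s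

open Classical in
/-- The descent set of a standard filling. -/
def Des (D : DescentKind) {α β : Comp} (T : StdFilling α β) : Finset ℕ :=
  (Finset.Icc 1 (α.size - β.size)).filter fun i =>
    ∃ c d, (T c).1 = i ∧ (T d).1 = i + 1 ∧ D.Rel c.1.1 d.1.1

/-- `∑ F_{comp(Des(T))}` over the standard tableaux `T` of shape `α / β`. -/
def tableauSum (D : DescentKind) (C : Set ℕ) (α β : Comp) : QSym :=
  ∑ T ∈ ST C α β, F (Comp.ofSet (α.size - β.size) (Des D T))

/-- `𝒮_α = ∑ F_{comp(Des(U))}` over the standard tableaux `U` of shape `α`. -/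
def Sk (D : DescentKind) (C : Set ℕ) (α : Comp) : QSym :=
  tableauSum D C α Comp.empty

/-- In every column with index in `C`, each cell of `α` below a cell of `β` also belongs to `β`. -/
def Justified (C : Set ℕ) (α β : Comp) : Prop :=
  ∀ i i' j, j ∈ C → i' < i → j < β.part i → j < α.part i' → j < β.part i'

/-- `β` is the shape formed by the entries `1, …, |β|` of some standard tableau of shape `α` with
increasing rows and with increasing columns in `C`. -/
def Occurs (C : Set ℕ) (α β : Comp) : Prop :=
  ∃ U ∈ ST C α Comp.empty, ∀ c, (U c).1 ≤ β.size ↔ c.1.2 < β.part c.1.1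

end QSymSkew

end

open QSymSkew

noncomputable section

namespace QSymSkew

/-! ### Compositions, containment and partial sums. -/

namespace Comp

/-! The coproduct of a fundamental function is cutting: `F` of a descent set on `{1, …, n}` goes to
the sum over `k` of `F` of the descents before `k` tensored with `F` of the descents after `k`,
lowered by `k` (`Δ_F_ofSet`). A descent at `k` itself is forgotten. This is read off in the monomial
basis, where `Δ` is dual to concatenation (`repr_Δ`) and where `F` tests inclusion of sets of
partial sums (`repr_F`).

Tableaux are cut in the same way. In a standard tableau `U` of shape `α`, the entries up to `k` fill
the diagram of a composition `β` of `k`: increasing rows make it left-justified, and the increasing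
first column leaves no empty row below a nonempty one (`exists_hasShape`). Increasing columns make
`β` justified (`justified_of_hasShape`). Conversely, tableaux of shapes `β` and `α / β` glue to one
of shape `α` as soon as `β` is justified (`glue_mem_ST`). Cutting keeps every cell in its row, so
each of the four descent sets is cut along with the tableau. Summing over `U` and `k` gives the
equation (`sum_hasShape`, `isSkewFamily_tableauSum`).

For uniqueness, a functional that kills every other left factor but not that of `β` isolates the
coefficient of `β` (`IsSkewFamily.unique`). For the first two descent sets such functionals always
exist, because the tableau sums are linearly independent (`linearIndependent_Sk`). In the expansion
into fundamental functions, the descent set of the row reading tableau of `γ` occurs only for `γ`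
itself and for shapes of smaller row weight (`eq_or_rowWeight_lt`). -/

theorem part_of_lt {α : Comp} {i : ℕ} (h : i < α.len) : α.part i = α.parts[i] :=
  List.getD_eq_getElem _ _ h

theorem part_pos_iff {α : Comp} {i : ℕ} : 0 < α.part i ↔ i < α.len := by
  refine ⟨fun h => ?_, fun h => ?_⟩
  · by_contra hi
    exact h.ne' (List.getD_eq_default _ _ (not_lt.mp hi))
  · rw [part_of_lt h]
    exact α.2.blocks_pos (List.getElem_mem h)

theorem ext_part {α β : Comp} (h : ∀ i, α.part i = β.part i) : α = β := by
  have hl : α.len = β.len := by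
    have : ∀ i, i < α.len ↔ i < β.len := fun i => by
      rw [← part_pos_iff, ← part_pos_iff, h]
    have h1 := this α.len
    have h2 := this β.len
    omega
  refine ext_parts (List.ext_getElem hl fun i h1 h2 => ?_)
  rw [← part_of_lt h1, ← part_of_lt h2, h]

/-- The parts are the values before the first zero; the second hypothesis keeps all later values
zero, so nothing is lost. -/
theorem exists_part_eq {f : ℕ → ℕ} {N : ℕ} (hN : f N = 0)
    (hf : ∀ i, f i = 0 → f (i + 1) = 0) : ∃ β : Comp, ∀ i, β.part i = f i := by
  classical
  have hex : ∃ m, f m = 0 := ⟨N, hN⟩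
  refine ⟨ofList ((List.range (Nat.find hex)).map f) fun a ha => ?_, fun i => ?_⟩
  · obtain ⟨i, hi, rfl⟩ := List.mem_map.mp ha
    exact Nat.pos_of_ne_zero (Nat.find_min hex (List.mem_range.mp hi))
  · change ((List.range (Nat.find hex)).map f).getD i 0 = f i
    by_cases hi : i < Nat.find hex
    · rw [List.getD_eq_getElem _ _ (by simpa using hi)]
      simp
    · rw [List.getD_eq_default _ _ (by simpa using hi)]
      have : ∀ k, f (Nat.find hex + k) = 0 := fun k => by
        induction k with
        | zero => exact Nat.find_spec hex
        | succ k ih => exact hf _ ih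
      have h := this (i - Nat.find hex)
      rw [Nat.add_sub_cancel' (not_lt.mp hi)] at h
      exact h.symm

@[simp] theorem empty_part (i : ℕ) : empty.part i = 0 := rfl

theorem contained_iff {α β : Comp} : β.Contained α ↔ ∀ i, β.part i ≤ α.part i := by
  refine ⟨fun h i => ?_, fun h => ⟨?_, fun i _ => h i⟩⟩
  · by_cases hi : i < β.len
    · exact h.2 i hi
    · rw [← part_pos_iff] at hi
      omega
  · by_contra hl
    have h1 := part_pos_iff.mpr (not_le.mp hl)
    have h2 := part_pos_iff.mp (h1.trans_le (h _))
    omega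

/-- Concatenation of compositions. -/
def append (β γ : Comp) : Comp := ⟨β.size + γ.size, β.2.append γ.2⟩

theorem append_parts (β γ : Comp) : (append β γ).parts = β.parts ++ γ.parts := rfl

theorem append_size (β γ : Comp) : (append β γ).size = β.size + γ.size := rfl

theorem append_take_drop (α : Comp) (k : ℕ) : append (α.take k) (α.drop k) = α :=
  ext_parts (List.take_append_drop k α.parts)

theorem take_append_len (β γ : Comp) : (append β γ).take β.len = β :=
  ext_parts (List.take_left' rfl)

theorem drop_append_len (β γ : Comp) : (append β γ).drop β.len = γ :=
  ext_parts (List.drop_left' rfl)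

/-- The set of partial sums of a composition, including `0` and its size. -/
def bounds (α : Comp) : Set ℕ := Set.range fun k => (α.parts.take k).sum

theorem zero_mem_bounds (α : Comp) : 0 ∈ α.bounds := ⟨0, by simp⟩

theorem size_mem_bounds (α : Comp) : α.size ∈ α.bounds :=
  ⟨α.len, by simp [α.2.blocks_sum]⟩

theorem le_size_of_mem_bounds {α : Comp} {m : ℕ} (h : m ∈ α.bounds) : m ≤ α.size := by
  obtain ⟨k, rfl⟩ := h
  exact α.2.sizeUpTo_le k

theorem mem_bounds_iff_boundaries {α : Comp} (m : Fin (α.size + 1)) :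
    (m : ℕ) ∈ α.bounds ↔ m ∈ α.2.boundaries := by
  simp only [Composition.boundaries, Finset.mem_map, Finset.mem_univ, true_and]
  constructor
  · rintro ⟨k, hk⟩
    -- In `bounds` the index `k` is unrestricted, and the partial sums are constant beyond the
    -- length.
    refine ⟨⟨min k α.len, ?_⟩, Fin.ext ?_⟩
    · exact Nat.lt_succ_of_le (min_le_right _ _)
    · rw [← hk]
      rcases le_total k α.len with h | h
      · change (α.parts.take (min k α.len)).sum = _
        rw [min_eq_left h]
      · change (α.parts.take (min k α.len)).sum = (α.parts.take k).sum
        rw [min_eq_right h, List.take_of_length_le h, List.take_of_length_le le_rfl]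
  · rintro ⟨i, rfl⟩
    exact ⟨i, rfl⟩

theorem bounds_injective : Function.Injective bounds := by
  intro α β h
  have hs : α.size = β.size :=
    le_antisymm (le_size_of_mem_bounds (h ▸ α.size_mem_bounds))
      (le_size_of_mem_bounds (h ▸ β.size_mem_bounds))
  obtain ⟨n, a⟩ := α
  obtain ⟨m, b⟩ := β
  change n = m at hs
  subst hs
  congr 1
  apply (compositionEquiv n).injective
  apply CompositionAsSet.ext
  change a.boundaries = b.boundaries
  ext m
  rw [← mem_bounds_iff_boundaries (α := ⟨n, a⟩), ← mem_bounds_iff_boundaries (α := ⟨n, b⟩), h]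

theorem mem_bounds_append {β γ : Comp} {m : ℕ} :
    m ∈ (append β γ).bounds ↔ m ∈ β.bounds ∨ ∃ j ∈ γ.bounds, m = β.size + j := by
  constructor
  · rintro ⟨k, rfl⟩
    simp only [append_parts, List.take_append, List.sum_append]
    rcases le_total k β.len with h | h
    · left
      exact ⟨k, by simp [Nat.sub_eq_zero_of_le h]⟩
    · right
      refine ⟨_, ⟨k - β.len, rfl⟩, ?_⟩
      rw [List.take_of_length_le h, β.2.blocks_sum]
  · rintro (⟨k, rfl⟩ | ⟨_, ⟨k, rfl⟩, rfl⟩)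
    · refine ⟨min k β.len, ?_⟩
      simp only [append_parts, List.take_append, List.sum_append]
      rw [Nat.sub_eq_zero_of_le (min_le_right _ _)]
      rcases le_total k β.len with h | h
      · simp [min_eq_left h]
      · simp [min_eq_right h, List.take_of_length_le h]
    · refine ⟨β.len + k, ?_⟩
      simp only [append_parts, List.take_append, List.sum_append]
      rw [List.take_of_length_le (Nat.le_add_right _ _), β.2.blocks_sum, Nat.add_sub_cancel_left]

theorem mem_bounds_ofSet {n : ℕ} {S : Finset ℕ} {m : ℕ} :
    m ∈ (ofSet n S).bounds ↔ m = 0 ∨ m = n ∨ (m < n ∧ m ∈ S) := by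
  by_cases hm : m ≤ n
  · have := mem_bounds_iff_boundaries (α := ofSet n S) ⟨m, Nat.lt_succ_of_le hm⟩
    rw [show m ∈ (ofSet n S).bounds ↔ _ from this]
    simp only [ofSet, CompositionAsSet.toComposition_boundaries]
    refine Finset.mem_filter.trans ?_
    simp only [Finset.mem_univ, true_and, Fin.ext_iff, Fin.val_last]
    change m = 0 ∨ m = n ∨ m ∈ S ↔ _
    grind
  · constructor
    · intro h
      exact absurd (le_size_of_mem_bounds h) hm
    · omega

theorem ofSet_injOn {n : ℕ} {S T : Finset ℕ} (hS : ∀ i ∈ S, 0 < i ∧ i < n)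
    (hT : ∀ i ∈ T, 0 < i ∧ i < n) (h : ofSet n S = ofSet n T) : S = T := by
  ext i
  have := Set.ext_iff.mp (congrArg bounds h) i
  rw [mem_bounds_ofSet, mem_bounds_ofSet] at this
  grind

/-- Induction on the coarse list: its first part is a partial sum of `b`, which tells where to cut
the first piece off; the remaining lists satisfy the same hypotheses. -/
theorem exists_flatten_eq {a b : List ℕ} (hb : ∀ x ∈ b, 0 < x) (hs : a.sum = b.sum)
    (h : ∀ k, ∃ m, (b.take m).sum = (a.take k).sum) :
    ∃ L : List (List ℕ), L.flatten = b ∧ L.map List.sum = a := by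
  induction a generalizing b with
  | nil =>
    refine ⟨[], ?_, rfl⟩
    cases b with
    | nil => rfl
    | cons x b =>
      have := hb x (by simp)
      simp at hs
      omega
  | cons x a ih =>
    obtain ⟨k, hk⟩ := h 1
    simp only [List.take_succ_cons, List.take_zero, List.sum_cons, List.sum_nil, add_zero] at hk
    have hsplit : ∀ m, (b.take (k + m)).sum = x + ((b.drop k).take m).sum := fun m => by
      rw [List.take_add, List.sum_append, hk]
    obtain ⟨L, hL, hLa⟩ := ih (b := b.drop k) (fun y hy => hb y (List.mem_of_mem_drop hy))
      (by
        have := congrArg List.sum (List.take_append_drop k b)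
        rw [List.sum_append, hk, ← hs, List.sum_cons] at this
        omega)
      (fun j => by
        obtain ⟨m, hm⟩ := h (j + 1)
        rw [List.take_succ_cons, List.sum_cons] at hm
        rcases le_total k m with hkm | hkm
        · refine ⟨m - k, ?_⟩
          have := hsplit (m - k)
          rw [Nat.add_sub_cancel' hkm] at this
          omega
        -- Here the partial sum of `b` stops within the first piece, so it is at most `x`; hence the
        -- first `j` entries of `a` sum to zero.
        · refine ⟨0, ?_⟩
          have h1 : (b.take m).sum ≤ (b.take k).sum := by
            rw [← Nat.add_sub_cancel' hkm, List.take_add, List.sum_append]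
            omega
          simp only [List.take_zero, List.sum_nil]
          omega)
    exact ⟨b.take k :: L, by simp [hL], by simp [hLa, hk]⟩

theorem refines_iff_bounds {α β : Comp} (h : α.size = β.size) :
    β.Refines α ↔ α.bounds ⊆ β.bounds := by
  constructor
  · rintro ⟨L, hL, hLa⟩ _ ⟨k, rfl⟩
    refine ⟨(L.take k).flatten.length, ?_⟩
    change (β.parts.take _).sum = (α.parts.take k).sum
    rw [← hLa, ← hL, ← List.map_take, ← List.sum_flatten]
    congr 1
    conv_lhs => rw [← List.take_append_drop k L, List.flatten_append]
    rw [List.take_append_drop]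
    exact List.take_left' rfl
  · intro hsub
    exact exists_flatten_eq (fun x hx => β.2.blocks_pos hx)
      (by rw [α.2.blocks_sum, β.2.blocks_sum]; exact h) fun k => hsub ⟨k, rfl⟩

end Comp

/-! ### Coordinates in the monomial basis -/

open Classical in
theorem repr_F (α γ : Comp) :
    M.repr (F α) γ = if γ.size = α.size ∧ α.bounds ⊆ γ.bounds then 1 else 0 := by
  simp only [F, map_sum, Module.Basis.repr_self, Finsupp.finsetSum_apply, Finsupp.single_apply]
  split_ifs with h
  · obtain ⟨n, a⟩ := α
    obtain ⟨m, c⟩ := γ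
    obtain ⟨h1, h2⟩ := h
    change m = n at h1
    subst h1
    rw [Finset.sum_eq_single c]
    · simp
    · intro b _ hb
      rw [if_neg]
      intro e
      exact hb (eq_of_heq (Sigma.mk.inj e).2)
    · intro hc
      refine absurd ?_ hc
      simpa using (Comp.refines_iff_bounds (α := ⟨m, a⟩) (β := ⟨m, c⟩) rfl).mpr h2
  · refine Finset.sum_eq_zero fun b hb => if_neg ?_
    rintro rfl
    refine h ⟨rfl, ?_⟩
    exact (Comp.refines_iff_bounds (α := α) (β := ⟨α.size, b⟩) rfl).mp (Finset.mem_filter.mp hb).2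

open Classical in
theorem repr_F_ofSet (n : ℕ) (S : Finset ℕ) (γ : Comp) :
    M.repr (F (Comp.ofSet n S)) γ =
      if γ.size = n ∧ ∀ i ∈ S, i < n → i ∈ γ.bounds then 1 else 0 := by
  rw [repr_F]
  refine if_congr (and_congr_right fun h => ?_) rfl rfl
  constructor
  · intro hs i hi hin
    exact hs (Comp.mem_bounds_ofSet.mpr (Or.inr (Or.inr ⟨hin, hi⟩)))
  · intro hs i hi
    rcases Comp.mem_bounds_ofSet.mp hi with rfl | rfl | ⟨h1, h2⟩
    · exact γ.zero_mem_bounds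
    · exact Set.mem_of_eq_of_mem h.symm γ.size_mem_bounds
    · exact hs i h2 h1

theorem repr_Δ (f : QSym) (β γ : Comp) :
    (M.tensorProduct M).repr (Δ f) (β, γ) = M.repr f (Comp.append β γ) := by
  classical
  have : Finsupp.lapply (β, γ) ∘ₗ (M.tensorProduct M).repr.toLinearMap ∘ₗ Δ =
      Finsupp.lapply (Comp.append β γ) ∘ₗ M.repr.toLinearMap := by
    refine M.ext fun α => ?_
    simp only [LinearMap.comp_apply, LinearEquiv.coe_coe, Finsupp.lapply_apply,
      Module.Basis.repr_self, Δ, Module.Basis.constr_basis, map_sum,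
      Module.Basis.tensorProduct_repr_tmul_apply, Finsupp.single_apply, smul_eq_mul]
    by_cases h : α = Comp.append β γ
    · subst h
      rw [Finset.sum_eq_single β.len]
      · rw [Comp.take_append_len, Comp.drop_append_len]
        simp
      · intro k hk hne
        rw [if_neg (c := (Comp.append β γ).take k = β), mul_zero]
        intro e
        apply hne
        have h1 := congrArg Comp.len e
        have h2 : ((Comp.append β γ).take k).len = min k (Comp.append β γ).len :=
          List.length_take
        have := Finset.mem_range.mp hk
        omega
      · intro hk
        refine absurd ?_ hk
        have : (Comp.append β γ).len = β.len + γ.len := List.length_append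
        rw [Finset.mem_range]
        omega
    · rw [if_neg h]
      refine Finset.sum_eq_zero fun k _ => ?_
      by_cases h1 : α.take k = β
      · by_cases h2 : α.drop k = γ
        · exact absurd (by rw [← h1, ← h2, Comp.append_take_drop]) h
        · rw [if_neg h2, zero_mul]
      · rw [if_neg h1, mul_zero]
  exact LinearMap.congr_fun this f

/-- The positive elements of `S - k`. -/
def shift (k : ℕ) (S : Finset ℕ) : Finset ℕ := (S.filter (k < ·)).image (· - k)

theorem mem_shift {k i : ℕ} {S : Finset ℕ} : i ∈ shift k S ↔ 0 < i ∧ k + i ∈ S := by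
  simp only [shift, Finset.mem_image, Finset.mem_filter]
  constructor
  · rintro ⟨a, ⟨ha, hk⟩, rfl⟩
    exact ⟨by omega, by rwa [Nat.add_sub_cancel' hk.le]⟩
  · rintro ⟨h1, h2⟩
    exact ⟨k + i, ⟨h2, by omega⟩, by omega⟩

/-- Coefficients are compared at `M β ⊗ M γ`, where only `k = |β|` contributes. The left factor
needs no truncation of `S`, since `Comp.ofSet k` ignores elements from `k` on. -/
theorem Δ_F_ofSet (n : ℕ) (S : Finset ℕ) :
    Δ (F (Comp.ofSet n S)) = ∑ k ∈ Finset.range (n + 1),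
      F (Comp.ofSet k S) ⊗ₜ[ℚ] F (Comp.ofSet (n - k) (shift k S)) := by
  classical
  refine (M.tensorProduct M).ext_elem fun ⟨β, γ⟩ => ?_
  rw [repr_Δ, repr_F_ofSet]
  simp only [map_sum, Finsupp.finsetSum_apply, Module.Basis.tensorProduct_repr_tmul_apply,
    repr_F_ofSet, smul_eq_mul]
  have hsize := Comp.append_size β γ
  by_cases hn : β.size + γ.size = n
  · rw [Finset.sum_eq_single β.size]
    · rw [ite_zero_mul_ite_zero, mul_one]
      refine if_congr ?_ rfl rfl
      simp only [hsize, hn, true_and, Comp.mem_bounds_append, mem_shift]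
      constructor
      · intro h
        refine ⟨⟨by omega, fun i hi hin => ?_⟩, fun i hi hin => ?_⟩
        · rcases h _ hi.2 (by omega) with h1 | ⟨j, hj, hj'⟩
          · have := Comp.le_size_of_mem_bounds h1
            omega
          · rwa [Nat.add_left_cancel hj']
        · rcases h i hi (by omega) with h1 | ⟨j, hj, hj'⟩
          · exact h1
          · exact absurd hin (by omega)
      · rintro ⟨⟨-, h2⟩, h1⟩ i hi hin
        rcases lt_trichotomy i β.size with h | h | h
        · exact Or.inl (h1 i hi h)
        -- The cut point `|β|` is always a partial sum of the concatenation, so its membership in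
        -- `S` imposes no condition.
        · exact Or.inl (h ▸ β.size_mem_bounds)
        · refine Or.inr ⟨i - β.size, h2 _ ⟨by omega, ?_⟩ (by omega), by omega⟩
          rwa [Nat.add_sub_cancel' h.le]
    · intro k _ hk
      rw [if_neg (c := β.size = k ∧ _) (fun h => hk h.1.symm), mul_zero]
    · intro h
      exact absurd (Finset.mem_range.mpr (by omega)) h
  · rw [if_neg (fun h => hn (hsize.symm.trans h.1))]
    refine (Finset.sum_eq_zero fun k hk => ?_).symm
    have := Finset.mem_range.mp hk
    by_cases h : β.size = k
    · rw [if_neg (c := γ.size = n - k ∧ _) (fun h' => hn (by omega)), zero_mul]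
    · rw [if_neg (c := β.size = k ∧ _) (fun h' => h h'.1), mul_zero]

/-! ### Linear independence by triangularity -/

/-- In a vanishing combination take an index `i` of least weight with nonzero coefficient. Then `f
i` annihilates all other terms, because a surviving one would have smaller weight. -/
theorem linearIndependent_of_triangular {ι V : Type*} [AddCommGroup V] [Module ℚ V] (v : ι → V)
    (w : ι → ℕ) (f : ι → V →ₗ[ℚ] ℚ) (hf : ∀ i, f i (v i) ≠ 0)
    (htri : ∀ i j, f i (v j) ≠ 0 → j = i ∨ w j < w i) : LinearIndependent ℚ v := by
  classical
  rw [linearIndependent_iff']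
  intro s g hg
  by_contra! hne
  obtain ⟨i, hi, hmin⟩ := Finset.exists_min_image (s.filter fun i => g i ≠ 0) w
    (by obtain ⟨i, h1, h2⟩ := hne; exact ⟨i, Finset.mem_filter.mpr ⟨h1, h2⟩⟩)
  have h := congrArg (f i) hg
  rw [map_sum, map_zero, Finset.sum_eq_single i] at h
  · rw [map_smul, smul_eq_mul, mul_eq_zero] at h
    exact h.elim (Finset.mem_filter.mp hi).2 (hf i)
  · intro j hj hji
    rw [map_smul, smul_eq_mul]
    by_contra hmul
    have hgj := left_ne_zero_of_mul hmul
    rcases htri i j (right_ne_zero_of_mul hmul) with h1 | h1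
    · exact hji h1
    · exact absurd (hmin j (Finset.mem_filter.mpr ⟨hj, hgj⟩)) (not_le.mpr h1)
  · intro h'
    exact absurd (Finset.mem_filter.mp hi).1 h'

theorem linearIndependent_F : LinearIndependent ℚ F := by
  classical
  have hfin : ∀ α : Comp, α.bounds.Finite := fun α =>
    (Set.finite_Iic α.size).subset fun _ h => Comp.le_size_of_mem_bounds h
  refine linearIndependent_of_triangular F (fun α => α.bounds.ncard)
    (fun α => Finsupp.lapply α ∘ₗ M.repr.toLinearMap) (fun α => ?_) fun α β h => ?_
  · simp [repr_F]
  · simp only [LinearMap.comp_apply, LinearEquiv.coe_coe, Finsupp.lapply_apply, repr_F, ne_eq,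
      ite_eq_right_iff, not_forall] at h
    obtain ⟨⟨-, h⟩, -⟩ := h
    rcases h.eq_or_ssubset with h | h
    · exact Or.inl (Comp.bounds_injective h)
    · exact Or.inr (Set.ncard_lt_ncard h (hfin α))

/-! ### Cells, standard fillings and their descents. -/

namespace Comp

theorem part_le_size (α : Comp) (i : ℕ) : α.part i ≤ α.size := by
  by_cases h : i < α.len
  · rw [part_of_lt h]
    exact α.2.blocks_le (List.getElem_mem h)
  · rw [← part_pos_iff] at h
    omega

theorem sizeUpTo_succ (α : Comp) (r : ℕ) :
    α.2.sizeUpTo (r + 1) = α.2.sizeUpTo r + α.part r := by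
  by_cases h : r < α.len
  · rw [part_of_lt h]
    exact α.2.sizeUpTo_succ h
  · have h0 : α.part r = 0 := by
      rw [← part_pos_iff] at h
      omega
    rw [α.2.sizeUpTo_ofLength_le r (not_lt.mp h),
      α.2.sizeUpTo_ofLength_le (r + 1) (by have := not_lt.mp h; exact this.trans (Nat.le_succ r)),
      h0, add_zero]

theorem mem_below {α β : Comp} : β ∈ α.below ↔ β.Contained α ∧ β.size ≤ α.size := by
  simp only [below, Finset.mem_filter, Finset.mem_sigma, Finset.mem_range, Finset.mem_univ,
    and_true, Nat.lt_succ_iff]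
  exact and_comm

theorem ofSet_congr {n : ℕ} {S T : Finset ℕ} (h : ∀ i, 0 < i → i < n → (i ∈ S ↔ i ∈ T)) :
    ofSet n S = ofSet n T := by
  apply bounds_injective
  ext i
  rw [mem_bounds_ofSet, mem_bounds_ofSet]
  have := h i
  grind

end Comp

theorem mem_cells {α β : Comp} {c : ℕ × ℕ} :
    c ∈ cells α β ↔ β.part c.1 ≤ c.2 ∧ c.2 < α.part c.1 := by
  simp only [cells, Finset.mem_filter, Finset.mem_product, Finset.mem_range]
  refine ⟨fun h => h.2, fun h => ⟨⟨?_, ?_⟩, h⟩⟩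
  · exact Comp.part_pos_iff.mp (by omega)
  · exact h.2.trans_le (α.part_le_size _)

theorem mem_cells_empty {α : Comp} {c : ℕ × ℕ} :
    c ∈ cells α Comp.empty ↔ c.2 < α.part c.1 := by
  simp [mem_cells]

theorem mem_ST {C : Set ℕ} {α β : Comp} {T : StdFilling α β} : T ∈ ST C α β ↔
    (∀ c d, c.1.1 = d.1.1 → c.1.2 < d.1.2 → (T c).1 < (T d).1) ∧
    (∀ c d, c.1.2 = d.1.2 → c.1.2 ∈ C → c.1.1 < d.1.1 → (T c).1 < (T d).1) := by
  simp [ST]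

theorem StdFilling.one_le {α β : Comp} (T : StdFilling α β) (c : {c // c ∈ cells α β}) :
    1 ≤ (T c).1 := (Finset.mem_Icc.mp (T c).2).1

theorem StdFilling.le_size {α β : Comp} (T : StdFilling α β) (c : {c // c ∈ cells α β}) :
    (T c).1 ≤ α.size - β.size := (Finset.mem_Icc.mp (T c).2).2

theorem StdFilling.eq_of_val_eq {α β : Comp} (T : StdFilling α β) {c d : {c // c ∈ cells α β}}
    (h : (T c).1 = (T d).1) : c = d := T.injective (Subtype.ext h)

theorem StdFilling.exists_val_eq {α β : Comp} (T : StdFilling α β) {i : ℕ} (h1 : 1 ≤ i)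
    (h2 : i ≤ α.size - β.size) : ∃ c, (T c).1 = i := by
  obtain ⟨c, hc⟩ := T.surjective ⟨i, Finset.mem_Icc.mpr ⟨h1, h2⟩⟩
  exact ⟨c, congrArg Subtype.val hc⟩

theorem mem_Des {D : DescentKind} {α β : Comp} {T : StdFilling α β} {i : ℕ} :
    i ∈ Des D T ↔ ∃ c d, (T c).1 = i ∧ (T d).1 = i + 1 ∧ D.Rel c.1.1 d.1.1 := by
  simp only [Des, Finset.mem_filter, and_iff_right_iff_imp]
  rintro ⟨c, d, rfl, -⟩
  exact (T c).2

theorem mem_Des_bounds {D : DescentKind} {α β : Comp} {T : StdFilling α β} {i : ℕ}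
    (h : i ∈ Des D T) : 0 < i ∧ i < α.size - β.size := by
  obtain ⟨c, d, rfl, hd, -⟩ := mem_Des.mp h
  exact ⟨T.one_le c, by have := T.le_size d; omega⟩

theorem mem_Des_iff {D : DescentKind} {α β : Comp} {T : StdFilling α β}
    {c d : {c // c ∈ cells α β}} (h : (T d).1 = (T c).1 + 1) :
    (T c).1 ∈ Des D T ↔ D.Rel c.1.1 d.1.1 := by
  rw [mem_Des]
  constructor
  · rintro ⟨c', d', hc, hd, hr⟩
    rwa [T.eq_of_val_eq hc, T.eq_of_val_eq (hd.trans h.symm)] at hr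
  · exact fun hr => ⟨c, d, rfl, h, hr⟩

/-! ### The row reading tableau -/

theorem rowReading_lt {γ : Comp} {r s j k : ℕ} (hj : j < γ.part r) (hrs : r < s) :
    γ.2.sizeUpTo r + j + 1 < γ.2.sizeUpTo s + k + 1 := by
  have h1 := γ.sizeUpTo_succ r
  have h2 : γ.2.sizeUpTo (r + 1) ≤ γ.2.sizeUpTo s := γ.2.monotone_sizeUpTo hrs
  omega

theorem rowReading_mem (γ : Comp) (c : {c // c ∈ cells γ Comp.empty}) :
    γ.2.sizeUpTo c.1.1 + c.1.2 + 1 ∈ Finset.Icc 1 (γ.size - Comp.empty.size) := by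
  have h1 := γ.sizeUpTo_succ c.1.1
  have h2 : γ.2.sizeUpTo (c.1.1 + 1) ≤ γ.size := γ.2.sizeUpTo_le _
  have h3 := mem_cells_empty.mp c.2
  have h4 : Comp.empty.size = 0 := rfl
  rw [Finset.mem_Icc]
  omega

/-- The tableau of shape `γ` whose rows, read from the bottom to the top, give `1, 2, …`. -/
def rowReading (γ : Comp) : StdFilling γ Comp.empty :=
  Equiv.ofBijective (fun c => ⟨γ.2.sizeUpTo c.1.1 + c.1.2 + 1, rowReading_mem γ c⟩) (by
    constructor
    · intro c d h
      have h := congrArg Subtype.val h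
      change γ.2.sizeUpTo c.1.1 + c.1.2 + 1 = γ.2.sizeUpTo d.1.1 + d.1.2 + 1 at h
      have hr : c.1.1 = d.1.1 := by
        rcases lt_trichotomy c.1.1 d.1.1 with h' | h' | h'
        · exact absurd h (rowReading_lt (mem_cells_empty.mp c.2) h').ne
        · exact h'
        · exact absurd h (rowReading_lt (mem_cells_empty.mp d.2) h').ne'
      rw [hr] at h
      exact Subtype.ext (Prod.ext hr (by omega))
    · rintro ⟨i, hi⟩
      have hi' : 1 ≤ i ∧ i ≤ γ.size := Finset.mem_Icc.mp hi
      have hlt : i - 1 < γ.size := by omega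
      have h1 := γ.2.sizeUpTo_index_le ⟨i - 1, hlt⟩
      have h2 := γ.2.lt_sizeUpTo_index_succ ⟨i - 1, hlt⟩
      set r : ℕ := (γ.2.index ⟨i - 1, hlt⟩ : ℕ)
      have h3 := γ.sizeUpTo_succ r
      change i - 1 < γ.2.sizeUpTo (r + 1) at h2
      change γ.2.sizeUpTo r ≤ i - 1 at h1
      refine ⟨⟨(r, i - 1 - γ.2.sizeUpTo r), mem_cells_empty.mpr ?_⟩, Subtype.ext ?_⟩
      · change i - 1 - γ.2.sizeUpTo r < γ.part r
        omega
      · change γ.2.sizeUpTo r + (i - 1 - γ.2.sizeUpTo r) + 1 = i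
        omega)

theorem rowReading_val (γ : Comp) (c : {c // c ∈ cells γ Comp.empty}) :
    (rowReading γ c).1 = γ.2.sizeUpTo c.1.1 + c.1.2 + 1 := rfl

theorem rowReading_mem_ST (C : Set ℕ) (γ : Comp) : rowReading γ ∈ ST C γ Comp.empty := by
  refine mem_ST.mpr ⟨fun c d h h' => ?_, fun c d _ _ h => ?_⟩
  · rw [rowReading_val, rowReading_val, h]
    omega
  · exact rowReading_lt (mem_cells_empty.mp c.2) h

theorem row_le_of_rowReading_le {γ : Comp} {c d : {c // c ∈ cells γ Comp.empty}}
    (h : (rowReading γ c).1 ≤ (rowReading γ d).1) : c.1.1 ≤ d.1.1 := by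
  by_contra hlt
  exact absurd h (not_le.mpr (rowReading_lt (mem_cells_empty.mp d.2) (not_le.mp hlt)))

theorem card_cells_empty (γ : Comp) : (cells γ Comp.empty).card = γ.size := by
  have := Fintype.card_congr (rowReading γ)
  rw [Fintype.card_coe, Fintype.card_coe, Nat.card_Icc] at this
  exact this

theorem Comp.Contained.size_le {α β : Comp} (h : β.Contained α) : β.size ≤ α.size := by
  rw [← card_cells_empty α, ← card_cells_empty β]
  refine Finset.card_le_card fun c hc => ?_
  rw [mem_cells_empty] at hc ⊢
  exact hc.trans_le (Comp.contained_iff.mp h _)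

/-! ### Cutting a tableau at a value -/

/-- The entries `1, …, k` of the filling `U` occupy the diagram of `β`. -/
def HasShape {α : Comp} (U : StdFilling α Comp.empty) (β : Comp) (k : ℕ) : Prop :=
  ∀ c, (U c).1 ≤ k ↔ c.1.2 < β.part c.1.1

theorem cells_subset {α β : Comp} (h : β.Contained α) {c : ℕ × ℕ}
    (hc : c ∈ cells β Comp.empty) : c ∈ cells α Comp.empty :=
  mem_cells_empty.mpr ((mem_cells_empty.mp hc).trans_le (Comp.contained_iff.mp h _))

theorem cells_skew_subset {α β : Comp} {c : ℕ × ℕ} (hc : c ∈ cells α β) :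
    c ∈ cells α Comp.empty :=
  mem_cells_empty.mpr (mem_cells.mp hc).2

/-- The part of a filling with entries at most `k`. -/
def lowerPart {α β : Comp} (h : β.Contained α) (U : StdFilling α Comp.empty) {k : ℕ}
    (hk : k ≤ α.size) (hU : HasShape U β k) :
    {c // c ∈ cells β Comp.empty} ≃ {i // i ∈ Finset.Icc 1 k} where
  toFun c := ⟨(U ⟨c.1, cells_subset h c.2⟩).1,
    Finset.mem_Icc.mpr ⟨U.one_le _, (hU _).mpr (mem_cells_empty.mp c.2)⟩⟩
  invFun i := ⟨(U.symm ⟨i.1, Finset.mem_Icc.mpr ⟨(Finset.mem_Icc.mp i.2).1,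
      (Finset.mem_Icc.mp i.2).2.trans hk⟩⟩).1,
    mem_cells_empty.mpr ((hU _).mp (by
      rw [Equiv.apply_symm_apply]
      exact (Finset.mem_Icc.mp i.2).2))⟩
  left_inv c := by simp
  right_inv i := by simp

/-- The part of a filling with entries above `|β|`, lowered by `|β|`. -/
def upperPart {α β : Comp} (U : StdFilling α Comp.empty) (hU : HasShape U β β.size) :
    StdFilling α β :=
  have hlt : ∀ c : {c // c ∈ cells α β}, β.size < (U ⟨c.1, cells_skew_subset c.2⟩).1 := fun c => by
    by_contra h
    have := (hU _).mp (not_lt.mp h)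
    exact absurd (mem_cells.mp c.2).1 (not_le.mpr this)
  Equiv.ofBijective
    (fun c => ⟨(U ⟨c.1, cells_skew_subset c.2⟩).1 - β.size, Finset.mem_Icc.mpr
      ⟨Nat.sub_pos_of_lt (hlt c), Nat.sub_le_sub_right (U.le_size _) _⟩⟩) (by
    constructor
    · intro c d hcd
      have h1 := congrArg Subtype.val hcd
      change (U ⟨c.1, _⟩).1 - β.size = (U ⟨d.1, _⟩).1 - β.size at h1
      have h2 := hlt c
      have h3 := hlt d
      have := U.eq_of_val_eq (show (U ⟨c.1, cells_skew_subset c.2⟩).1 =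
        (U ⟨d.1, cells_skew_subset d.2⟩).1 by omega)
      exact Subtype.ext (congrArg (fun x => x.1) this :)
    · rintro ⟨i, hi⟩
      have hi' := Finset.mem_Icc.mp hi
      obtain ⟨c, hc⟩ := U.exists_val_eq (i := β.size + i) (by omega)
        (by change _ ≤ α.size; omega)
      refine ⟨⟨c.1, mem_cells.mpr ⟨?_, mem_cells_empty.mp c.2⟩⟩, Subtype.ext ?_⟩
      · by_contra h
        have := (hU c).mpr (not_le.mp h)
        omega
      · change (U c).1 - β.size = i
        omega)

theorem upperPart_val {α β : Comp} (U : StdFilling α Comp.empty) (hU : HasShape U β β.size)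
    (c : {c // c ∈ cells α β}) :
    (upperPart U hU c).1 = (U ⟨c.1, cells_skew_subset c.2⟩).1 - β.size := rfl

/-- In the first column, every entry of a tableau is larger than those below it. -/
theorem exists_lt_in_row_below {C : Set ℕ} (hC : 0 ∈ C) {α : Comp} {U : StdFilling α Comp.empty}
    (hU : U ∈ ST C α Comp.empty) (c : {c // c ∈ cells α Comp.empty}) {r : ℕ}
    (hr : r < c.1.1) :
    ∃ h : (r, 0) ∈ cells α Comp.empty, (U ⟨(r, 0), h⟩).1 < (U c).1 := by
  have hc : 0 < α.part c.1.1 := (Nat.zero_le _).trans_lt (mem_cells_empty.mp c.2)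
  have hr0 : (r, 0) ∈ cells α Comp.empty :=
    mem_cells_empty.mpr (Comp.part_pos_iff.mpr (hr.trans (Comp.part_pos_iff.mp hc)))
  have hc0 : (c.1.1, 0) ∈ cells α Comp.empty := mem_cells_empty.mpr hc
  refine ⟨hr0, ((mem_ST.mp hU).2 ⟨_, hr0⟩ ⟨_, hc0⟩ rfl hC hr).trans_le ?_⟩
  rcases (Nat.zero_le c.1.2).eq_or_lt with h | h
  · exact le_of_eq (congrArg (fun x => (U x).1) (Subtype.ext (Prod.ext rfl h)))
  · exact ((mem_ST.mp hU).1 ⟨_, hc0⟩ c rfl h).le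

/-- The length of row `r` of `β` is the first column in which `α` has no cell with an entry at most
`k`; since rows increase, the cells before it are exactly those with entries at most `k`. -/
theorem exists_hasShape {C : Set ℕ} (hC : 0 ∈ C) {α : Comp} {U : StdFilling α Comp.empty}
    (hU : U ∈ ST C α Comp.empty) {k : ℕ} (hk : k ≤ α.size) :
    ∃ β : Comp, β.Contained α ∧ β.size = k ∧ HasShape U β k := by
  classical
  have hex : ∀ r, ∃ j, ¬ ∃ h : (r, j) ∈ cells α Comp.empty, (U ⟨(r, j), h⟩).1 ≤ k := fun r =>
    ⟨α.part r, fun ⟨h, _⟩ => lt_irrefl _ (mem_cells_empty.mp h)⟩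
  have hlt : ∀ r j, j < Nat.find (hex r) ↔
      ∃ h : (r, j) ∈ cells α Comp.empty, (U ⟨(r, j), h⟩).1 ≤ k := by
    intro r j
    constructor
    · intro h
      exact not_not.mp (Nat.find_min (hex r) h)
    · rintro ⟨h, hle⟩
      by_contra hge
      refine Nat.find_spec (hex r) ?_
      have hmem : (r, Nat.find (hex r)) ∈ cells α Comp.empty :=
        mem_cells_empty.mpr ((not_lt.mp hge).trans_lt (mem_cells_empty.mp h))
      refine ⟨hmem, ?_⟩
      rcases (not_lt.mp hge).eq_or_lt with h' | h'
      · have : (U ⟨(r, Nat.find (hex r)), hmem⟩).1 = (U ⟨(r, j), h⟩).1 :=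
          congrArg (fun x => (U x).1) (Subtype.ext (Prod.ext rfl h'))
        omega
      · exact ((mem_ST.mp hU).1 ⟨_, hmem⟩ ⟨_, h⟩ rfl h').le.trans hle
  obtain ⟨β, hβ⟩ := Comp.exists_part_eq (f := fun r => Nat.find (hex r)) (N := α.len)
    (by
      by_contra h
      obtain ⟨h1, -⟩ := (hlt _ 0).mp (Nat.pos_of_ne_zero h)
      exact lt_irrefl _ (Comp.part_pos_iff.mp (mem_cells_empty.mp h1)))
    -- A nonempty row cannot lie above an empty one: its first entry exceeds the first entry of the
    -- row below.
    (fun r h => by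
      by_contra h'
      obtain ⟨h1, h2⟩ := (hlt _ 0).mp (Nat.pos_of_ne_zero h')
      obtain ⟨h3, h4⟩ := exists_lt_in_row_below hC hU ⟨_, h1⟩ (Nat.lt_succ_self r)
      exact absurd ((hlt r 0).mpr ⟨h3, h4.le.trans h2⟩) (by omega))
  have hshape : HasShape U β k := fun c => by
    rw [hβ, hlt]
    exact ⟨fun h => ⟨c.2, h⟩, fun ⟨_, h⟩ => h⟩
  have hcont : β.Contained α := Comp.contained_iff.mpr fun r => by
    rw [hβ]
    exact Nat.find_min' (hex r) fun ⟨h, _⟩ => lt_irrefl _ (mem_cells_empty.mp h)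
  refine ⟨β, hcont, ?_, hshape⟩
  -- The target of `lowerPart` is `{1, …, k}`, so counting cells yields `|β| = k`, which was not
  -- known before.
  have := Fintype.card_congr (lowerPart hcont U hk hshape)
  rw [Fintype.card_coe, Fintype.card_coe, Nat.card_Icc, card_cells_empty] at this
  exact this

/-- `HasShape` tests only the cells of `α`, which is why both shapes have to be contained in `α`. -/
theorem hasShape_unique {α β γ : Comp} {U : StdFilling α Comp.empty} {k : ℕ}
    (hβ : β.Contained α) (hγ : γ.Contained α) (h : HasShape U β k) (h' : HasShape U γ k) :
    β = γ := by
  refine Comp.ext_part fun r => ?_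
  have key : ∀ {β γ : Comp}, β.Contained α → HasShape U β k → HasShape U γ k →
      β.part r ≤ γ.part r := by
    intro β γ hβ h h'
    by_contra hlt
    have hc : (r, γ.part r) ∈ cells β Comp.empty := mem_cells_empty.mpr (not_le.mp hlt)
    have h1 := (h ⟨_, cells_subset hβ hc⟩).mpr (not_le.mp hlt)
    exact lt_irrefl _ ((h' ⟨_, cells_subset hβ hc⟩).mp h1)
  exact le_antisymm (key hβ h h') (key hγ h' h)

theorem justified_of_hasShape {C : Set ℕ} {α β : Comp} {U : StdFilling α Comp.empty} {k : ℕ}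
    (hβ : β.Contained α) (hU : U ∈ ST C α Comp.empty) (h : HasShape U β k) :
    Justified C α β := by
  intro i i' j hj hi hij hij'
  have hc : (i, j) ∈ cells α Comp.empty := cells_subset hβ (mem_cells_empty.mpr hij)
  have hd : (i', j) ∈ cells α Comp.empty := mem_cells_empty.mpr hij'
  have h1 := (h ⟨_, hc⟩).mpr hij
  have h2 := (mem_ST.mp hU).2 ⟨_, hd⟩ ⟨_, hc⟩ rfl hj hi
  exact (h ⟨_, hd⟩).mp (h2.le.trans h1)

/-! ### Gluing tableaux -/

theorem mem_cells_skew_of_notMem {α β : Comp} {c : ℕ × ℕ} (hc : c ∈ cells α Comp.empty)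
    (h : c ∉ cells β Comp.empty) : c ∈ cells α β :=
  mem_cells.mpr ⟨not_lt.mp fun h' => h (mem_cells_empty.mpr h'), mem_cells_empty.mp hc⟩

open Classical in
/-- The entry of the glued filling at a cell. -/
def glueFun {α β : Comp} (T : StdFilling β Comp.empty) (V : StdFilling α β)
    (c : {c // c ∈ cells α Comp.empty}) : ℕ :=
  if h : c.1 ∈ cells β Comp.empty then (T ⟨c.1, h⟩).1
  else β.size + (V ⟨c.1, mem_cells_skew_of_notMem c.2 h⟩).1

theorem glueFun_of_mem {α β : Comp} (T : StdFilling β Comp.empty) (V : StdFilling α β)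
    (c : {c // c ∈ cells α Comp.empty}) (h : c.1 ∈ cells β Comp.empty) :
    glueFun T V c = (T ⟨c.1, h⟩).1 := dif_pos h

theorem glueFun_of_notMem {α β : Comp} (T : StdFilling β Comp.empty) (V : StdFilling α β)
    (c : {c // c ∈ cells α Comp.empty}) (h : c.1 ∉ cells β Comp.empty) :
    glueFun T V c = β.size + (V ⟨c.1, mem_cells_skew_of_notMem c.2 h⟩).1 := dif_neg h

theorem glueFun_le_iff {α β : Comp} (T : StdFilling β Comp.empty) (V : StdFilling α β)
    (c : {c // c ∈ cells α Comp.empty}) :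
    glueFun T V c ≤ β.size ↔ c.1 ∈ cells β Comp.empty := by
  by_cases h : c.1 ∈ cells β Comp.empty
  · rw [glueFun_of_mem T V c h]
    exact iff_of_true (T.le_size _) h
  · rw [glueFun_of_notMem T V c h]
    have := V.one_le ⟨c.1, mem_cells_skew_of_notMem c.2 h⟩
    exact iff_of_false (by omega) h

/-- The filling of `α` made of a filling of `β` and, above it, a filling of `α / β`. -/
def glue {α β : Comp} (hβ : β.Contained α) (T : StdFilling β Comp.empty) (V : StdFilling α β) :
    StdFilling α Comp.empty :=
  Equiv.ofBijective (fun c => ⟨glueFun T V c, by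
      have hs := hβ.size_le
      rw [Finset.mem_Icc]
      change 1 ≤ _ ∧ _ ≤ α.size
      by_cases h : c.1 ∈ cells β Comp.empty
      · rw [glueFun_of_mem T V c h]
        exact ⟨T.one_le _, (T.le_size _).trans hs⟩
      · rw [glueFun_of_notMem T V c h]
        have h1 := V.one_le ⟨c.1, mem_cells_skew_of_notMem c.2 h⟩
        have h2 := V.le_size ⟨c.1, mem_cells_skew_of_notMem c.2 h⟩
        omega⟩) (by
    constructor
    · intro c d hcd
      have hcd : glueFun T V c = glueFun T V d := congrArg Subtype.val hcd
      have hiff : c.1 ∈ cells β Comp.empty ↔ d.1 ∈ cells β Comp.empty := by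
        rw [← glueFun_le_iff T V, ← glueFun_le_iff T V, hcd]
      by_cases h : c.1 ∈ cells β Comp.empty
      · rw [glueFun_of_mem T V c h, glueFun_of_mem T V d (hiff.mp h)] at hcd
        exact Subtype.ext (congrArg (fun x => x.1) (T.eq_of_val_eq hcd) :)
      · rw [glueFun_of_notMem T V c h, glueFun_of_notMem T V d (mt hiff.mpr h)] at hcd
        exact Subtype.ext (congrArg (fun x => x.1) (V.eq_of_val_eq (Nat.add_left_cancel hcd)) :)
    · rintro ⟨i, hi⟩
      have hi' : 1 ≤ i ∧ i ≤ α.size := Finset.mem_Icc.mp hi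
      by_cases h : i ≤ β.size
      · obtain ⟨c, hc⟩ := T.exists_val_eq hi'.1 h
        exact ⟨⟨c.1, cells_subset hβ c.2⟩, Subtype.ext ((glueFun_of_mem T V _ c.2).trans hc)⟩
      · obtain ⟨c, hc⟩ := V.exists_val_eq (i := i - β.size) (by omega) (by omega)
        have hn : c.1 ∉ cells β Comp.empty := fun hm =>
          absurd (mem_cells.mp c.2).1 (not_le.mpr (mem_cells_empty.mp hm))
        refine ⟨⟨c.1, cells_skew_subset c.2⟩, Subtype.ext ((glueFun_of_notMem T V _ hn).trans ?_)⟩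
        change β.size + (V c).1 = i
        omega)

theorem glue_val {α β : Comp} (hβ : β.Contained α) (T : StdFilling β Comp.empty)
    (V : StdFilling α β) (c : {c // c ∈ cells α Comp.empty}) :
    (glue hβ T V c).1 = glueFun T V c := rfl

theorem hasShape_glue {α β : Comp} (hβ : β.Contained α) (T : StdFilling β Comp.empty)
    (V : StdFilling α β) : HasShape (glue hβ T V) β β.size := fun c => by
  rw [glue_val, glueFun_le_iff, mem_cells_empty]

/-- Entries on `α / β` exceed those on `β`, so the order can fail only if the later cell of a row or
column lies in `β` and the earlier one does not. In a row this is impossible because `β` is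
left-justified; in a column of `C` it is exactly what `Justified` forbids. -/
theorem glue_mem_ST {C : Set ℕ} {α β : Comp} (hβ : β.Contained α) (hJ : Justified C α β)
    {T : StdFilling β Comp.empty} {V : StdFilling α β} (hT : T ∈ ST C β Comp.empty)
    (hV : V ∈ ST C α β) : glue hβ T V ∈ ST C α Comp.empty := by
  have key : ∀ c d : {c // c ∈ cells α Comp.empty},
      (d.1 ∈ cells β Comp.empty → c.1 ∈ cells β Comp.empty) →
      (∀ h h', (T ⟨c.1, h⟩).1 < (T ⟨d.1, h'⟩).1) →
      (∀ h h', (V ⟨c.1, h⟩).1 < (V ⟨d.1, h'⟩).1) →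
      (glue hβ T V c).1 < (glue hβ T V d).1 := by
    intro c d hcd h1 h2
    rw [glue_val, glue_val]
    by_cases hd : d.1 ∈ cells β Comp.empty
    · rw [glueFun_of_mem T V c (hcd hd), glueFun_of_mem T V d hd]
      exact h1 _ _
    · by_cases hc : c.1 ∈ cells β Comp.empty
      · have h3 := (glueFun_le_iff T V c).mpr hc
        have h4 := mt (glueFun_le_iff T V d).mp hd
        omega
      · rw [glueFun_of_notMem T V c hc, glueFun_of_notMem T V d hd]
        exact Nat.add_lt_add_left (h2 _ _) _
  refine mem_ST.mpr ⟨fun c d hr hlt => key c d (fun hd => ?_) ?_ ?_,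
    fun c d hr hCc hlt => key c d (fun hd => ?_) ?_ ?_⟩
  · rw [mem_cells_empty] at hd ⊢
    rw [hr]
    exact hlt.trans hd
  · exact fun h h' => (mem_ST.mp hT).1 ⟨c.1, h⟩ ⟨d.1, h'⟩ hr hlt
  · exact fun h h' => (mem_ST.mp hV).1 ⟨c.1, h⟩ ⟨d.1, h'⟩ hr hlt
  · rw [mem_cells_empty] at hd ⊢
    exact hJ d.1.1 c.1.1 c.1.2 hCc hlt (by rwa [hr]) (mem_cells_empty.mp c.2)
  · exact fun h h' => (mem_ST.mp hT).2 ⟨c.1, h⟩ ⟨d.1, h'⟩ hr hCc hlt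
  · exact fun h h' => (mem_ST.mp hV).2 ⟨c.1, h⟩ ⟨d.1, h'⟩ hr hCc hlt

theorem lowerPart_mem_ST {C : Set ℕ} {α β : Comp} (hβ : β.Contained α)
    {U : StdFilling α Comp.empty} (hU : U ∈ ST C α Comp.empty) (hs : HasShape U β β.size) :
    (lowerPart hβ U hβ.size_le hs : StdFilling β Comp.empty) ∈ ST C β Comp.empty :=
  mem_ST.mpr ⟨fun c d hr hlt => (mem_ST.mp hU).1 ⟨c.1, _⟩ ⟨d.1, _⟩ hr hlt,
    fun c d hr hCc hlt => (mem_ST.mp hU).2 ⟨c.1, _⟩ ⟨d.1, _⟩ hr hCc hlt⟩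

theorem upperPart_lt {α β : Comp} {U : StdFilling α Comp.empty} (hs : HasShape U β β.size)
    {c d : {c // c ∈ cells α β}}
    (h : (U ⟨c.1, cells_skew_subset c.2⟩).1 < (U ⟨d.1, cells_skew_subset d.2⟩).1) :
    (upperPart U hs c).1 < (upperPart U hs d).1 := by
  have := (upperPart U hs).one_le c
  rw [upperPart_val] at this ⊢
  rw [upperPart_val]
  omega

theorem upperPart_mem_ST {C : Set ℕ} {α β : Comp}
    {U : StdFilling α Comp.empty} (hU : U ∈ ST C α Comp.empty) (hs : HasShape U β β.size) :
    upperPart U hs ∈ ST C α β :=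
  mem_ST.mpr ⟨fun c d hr hlt => upperPart_lt hs ((mem_ST.mp hU).1 ⟨c.1, _⟩ ⟨d.1, _⟩ hr hlt),
    fun c d hr hCc hlt => upperPart_lt hs ((mem_ST.mp hU).2 ⟨c.1, _⟩ ⟨d.1, _⟩ hr hCc hlt)⟩

theorem glue_parts {α β : Comp} (hβ : β.Contained α) (U : StdFilling α Comp.empty)
    (hs : HasShape U β β.size) :
    glue hβ (lowerPart hβ U hβ.size_le hs) (upperPart U hs) = U := by
  refine Equiv.ext fun c => Subtype.ext ?_
  rw [glue_val]
  by_cases h : c.1 ∈ cells β Comp.empty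
  · exact glueFun_of_mem _ _ c h
  · rw [glueFun_of_notMem _ _ c h]
    have := (upperPart U hs).one_le ⟨c.1, mem_cells_skew_of_notMem c.2 h⟩
    rw [upperPart_val] at this ⊢
    change 1 ≤ (U c).1 - β.size at this
    change β.size + ((U c).1 - β.size) = (U c).1
    omega

theorem glue_injective {α β : Comp} (hβ : β.Contained α) {T T' : StdFilling β Comp.empty}
    {V V' : StdFilling α β} (h : glue hβ T V = glue hβ T' V') : T = T' ∧ V = V' := by
  have hval : ∀ c, glueFun T V c = glueFun T' V' c := fun c => by
    rw [← glue_val hβ, ← glue_val hβ, h]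
  constructor
  · refine Equiv.ext fun c => Subtype.ext ?_
    have := hval ⟨c.1, cells_subset hβ c.2⟩
    rwa [glueFun_of_mem T V _ c.2, glueFun_of_mem T' V' _ c.2] at this
  · refine Equiv.ext fun c => Subtype.ext ?_
    have hn : c.1 ∉ cells β Comp.empty := fun hm =>
      absurd (mem_cells.mp c.2).1 (not_le.mpr (mem_cells_empty.mp hm))
    have := hval ⟨c.1, cells_skew_subset c.2⟩
    rw [glueFun_of_notMem T V _ hn, glueFun_of_notMem T' V' _ hn] at this
    exact Nat.add_left_cancel this

/-- Only `i < |β|` matters to `Comp.ofSet`, so `i` and `i + 1` both lie in `β`, in the same rows as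
before gluing. In the companion statement for `α / β`, `0 < i` puts both entries outside `β`. -/
theorem ofSet_Des_glue (D : DescentKind) {α β : Comp} (hβ : β.Contained α)
    (T : StdFilling β Comp.empty) (V : StdFilling α β) :
    Comp.ofSet β.size (Des D (glue hβ T V)) = Comp.ofSet β.size (Des D T) := by
  refine Comp.ofSet_congr fun i h0 hi => ?_
  rw [mem_Des, mem_Des]
  constructor
  · rintro ⟨c, d, hc, hd, hr⟩
    rw [glue_val] at hc hd
    have hc' := (glueFun_le_iff T V c).mp (by omega)
    have hd' := (glueFun_le_iff T V d).mp (by omega)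
    rw [glueFun_of_mem T V _ hc'] at hc
    rw [glueFun_of_mem T V _ hd'] at hd
    exact ⟨_, _, hc, hd, hr⟩
  · rintro ⟨c, d, hc, hd, hr⟩
    exact ⟨⟨c.1, cells_subset hβ c.2⟩, ⟨d.1, cells_subset hβ d.2⟩,
      (glueFun_of_mem T V _ c.2).trans hc, (glueFun_of_mem T V _ d.2).trans hd, hr⟩

theorem ofSet_shift_Des_glue (D : DescentKind) {α β : Comp} (hβ : β.Contained α)
    (T : StdFilling β Comp.empty) (V : StdFilling α β) :
    Comp.ofSet (α.size - β.size) (shift β.size (Des D (glue hβ T V))) =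
      Comp.ofSet (α.size - β.size) (Des D V) := by
  refine Comp.ofSet_congr fun i h0 hi => ?_
  rw [mem_shift, and_iff_right h0, mem_Des, mem_Des]
  constructor
  · rintro ⟨c, d, hc, hd, hr⟩
    rw [glue_val] at hc hd
    have hc' := mt (glueFun_le_iff T V c).mpr (by omega)
    have hd' := mt (glueFun_le_iff T V d).mpr (by omega)
    rw [glueFun_of_notMem T V _ hc'] at hc
    rw [glueFun_of_notMem T V _ hd'] at hd
    exact ⟨_, _, Nat.add_left_cancel hc, Nat.add_left_cancel (hd.trans (add_assoc _ _ _)), hr⟩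
  · rintro ⟨c, d, hc, hd, hr⟩
    have hn : ∀ c : {c // c ∈ cells α β}, c.1 ∉ cells β Comp.empty := fun c hm =>
      absurd (mem_cells.mp c.2).1 (not_le.mpr (mem_cells_empty.mp hm))
    refine ⟨⟨c.1, cells_skew_subset c.2⟩, ⟨d.1, cells_skew_subset d.2⟩,
      (glueFun_of_notMem T V _ (hn c)).trans ?_, (glueFun_of_notMem T V _ (hn d)).trans ?_, hr⟩
    · change β.size + (V c).1 = β.size + i
      rw [hc]
    · change β.size + (V d).1 = β.size + i + 1
      rw [hd, add_assoc]

/-! ### The skew functions -/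

open Classical in
-- If `β` is justified, gluing is a bijection from pairs of tableaux onto the tableaux that cut to
-- `β`; otherwise there are no such tableaux and both sides vanish.
theorem sum_hasShape (D : DescentKind) (C : Set ℕ) {α β : Comp} (hβ : β.Contained α) :
    ∑ U ∈ (ST C α Comp.empty).filter (fun U => HasShape U β β.size),
      F (Comp.ofSet β.size (Des D U)) ⊗ₜ[ℚ]
        F (Comp.ofSet (α.size - β.size) (shift β.size (Des D U))) =
    Sk D C β ⊗ₜ[ℚ] (if Justified C α β then tableauSum D C α β else 0) := by
  split_ifs with hJ
  · unfold Sk tableauSum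
    rw [TensorProduct.sum_tmul]
    simp_rw [TensorProduct.tmul_sum]
    rw [← Finset.sum_product']
    symm
    refine Finset.sum_bij (fun p _ => glue hβ p.1 p.2) ?_ ?_ ?_ ?_
    · rintro ⟨T, V⟩ hp
      obtain ⟨hT, hV⟩ := Finset.mem_product.mp hp
      exact Finset.mem_filter.mpr ⟨glue_mem_ST hβ hJ hT hV, hasShape_glue hβ T V⟩
    · rintro ⟨T, V⟩ - ⟨T', V'⟩ - h
      obtain ⟨h1, h2⟩ := glue_injective hβ h
      exact Prod.ext h1 h2
    · intro U hU
      obtain ⟨hU, hs⟩ := Finset.mem_filter.mp hU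
      exact ⟨(lowerPart hβ U hβ.size_le hs, upperPart U hs),
        Finset.mem_product.mpr ⟨lowerPart_mem_ST hβ hU hs, upperPart_mem_ST hU hs⟩,
        glue_parts hβ U hs⟩
    · rintro ⟨T, V⟩ -
      dsimp only
      rw [ofSet_Des_glue, ofSet_shift_Des_glue]
      rfl
  · rw [TensorProduct.tmul_zero]
    refine Finset.sum_eq_zero fun U hU => ?_
    obtain ⟨hU, hs⟩ := Finset.mem_filter.mp hU
    exact absurd (justified_of_hasShape hβ hU hs) hJ

open Classical in
theorem isSkewFamily_tableauSum (D : DescentKind) {C : Set ℕ} (hC : 0 ∈ C) (α : Comp) :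
    IsSkewFamily (Sk D C) α (fun β => if Justified C α β then tableauSum D C α β else 0) := by
  have hsum : ∀ U ∈ ST C α Comp.empty,
      Δ (F (Comp.ofSet (α.size - Comp.empty.size) (Des D U))) =
      ∑ β ∈ α.below with HasShape U β β.size, F (Comp.ofSet β.size (Des D U)) ⊗ₜ[ℚ]
        F (Comp.ofSet (α.size - β.size) (shift β.size (Des D U))) := by
    intro U hU
    change Δ (F (Comp.ofSet α.size (Des D U))) = _
    rw [Δ_F_ofSet]
    symm
    -- Each cut value `k` corresponds to exactly one shape of size `k` cut out of `U`.
    refine Finset.sum_bij (fun β _ => β.size) ?_ ?_ ?_ ?_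
    · intro β hβ
      have := (Comp.mem_below.mp (Finset.mem_filter.mp hβ).1).2
      exact Finset.mem_range.mpr (by omega)
    · intro β hβ γ hγ h
      obtain ⟨hβ, hβs⟩ := Finset.mem_filter.mp hβ
      obtain ⟨hγ, hγs⟩ := Finset.mem_filter.mp hγ
      exact hasShape_unique (Comp.mem_below.mp hβ).1 (Comp.mem_below.mp hγ).1 hβs (h ▸ hγs)
    · intro k hk
      obtain ⟨β, hβ, rfl, hs⟩ := exists_hasShape hC hU (Nat.lt_succ_iff.mp (Finset.mem_range.mp hk))
      exact ⟨β, Finset.mem_filter.mpr ⟨Comp.mem_below.mpr ⟨hβ, hβ.size_le⟩, hs⟩, rfl⟩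
    · intro β _
      rfl
  unfold IsSkewFamily
  conv_lhs => rw [Sk, tableauSum, map_sum, Finset.sum_congr rfl hsum]
  simp only [Finset.sum_filter]
  rw [Finset.sum_comm]
  refine Finset.sum_congr rfl fun β hβ => ?_
  rw [← Finset.sum_filter]
  exact sum_hasShape D C (Comp.mem_below.mp hβ).1

/-! ### Linear independence of the tableau sums -/

theorem Comp.ofSet_inj {m n : ℕ} {S T : Finset ℕ} (hS : ∀ i ∈ S, 0 < i ∧ i < m)
    (hT : ∀ i ∈ T, 0 < i ∧ i < n) (h : ofSet m S = ofSet n T) : m = n ∧ S = T := by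
  obtain rfl : m = n := congrArg size h
  exact ⟨rfl, ofSet_injOn hS hT h⟩

/-- These two relations are complementary, so either descent set determines when `i + 1` lies
strictly above `i`. The other two separate "strictly below" from "weakly above" and do not determine
this. -/
theorem DescentKind.rel_congr_lt {D : DescentKind}
    (hD : D = DescentKind.dualImmaculate ∨ D = DescentKind.rowStrictDualImmaculate)
    {r s r' s' : ℕ} (h : D.Rel r s ↔ D.Rel r' s') : r < s ↔ r' < s' := by
  rcases hD with rfl | rfl
  · exact h
  · have h : s ≤ r ↔ s' ≤ r' := h
    rw [← not_le, ← not_le, h]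

/-- Among tableaux with this descent set, the row reading tableau has every entry as high as
possible: a row can rise only at an ascent, and the first column forces a smaller entry in the row
just below. The bound covers all entries up to `i`, not only `i`, since the value of that smaller
entry is unknown. -/
theorem row_le_row_rowReading {D : DescentKind}
    (hD : D = DescentKind.dualImmaculate ∨ D = DescentKind.rowStrictDualImmaculate)
    {C : Set ℕ} (hC : 0 ∈ C) {α γ : Comp} (hs : α.size = γ.size) {U : StdFilling α Comp.empty}
    (hU : U ∈ ST C α Comp.empty) (hdes : Des D U = Des D (rowReading γ)) (i : ℕ)
    (c : {c // c ∈ cells α Comp.empty}) (d : {c // c ∈ cells γ Comp.empty})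
    (hd : (rowReading γ d).1 = i) (hc : (U c).1 ≤ i) : c.1.1 ≤ d.1.1 := by
  induction i generalizing c d with
  | zero =>
    have := U.one_le c
    omega
  | succ i ih =>
    have hi : i + 1 ≤ γ.size := hd ▸ (rowReading γ).le_size d
    rcases Nat.eq_zero_or_pos c.1.1 with h0 | h0
    · omega
    -- The first entry of the row below is positive and smaller than that of `c`, whence `i ≥ 1` and
    -- the entry `i` exists in both tableaux.
    obtain ⟨hm, hlt⟩ := exists_lt_in_row_below hC hU c (Nat.sub_lt h0 one_pos)
    have h1 := U.one_le ⟨_, hm⟩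
    obtain ⟨d', hd'⟩ := (rowReading γ).exists_val_eq (i := i) (by omega)
      (by change i ≤ γ.size; omega)
    have hdd : d'.1.1 ≤ d.1.1 := row_le_of_rowReading_le (by omega)
    rcases hc.lt_or_eq with hc | hc
    · exact (ih c d' hd' (by omega)).trans hdd
    · obtain ⟨c', hc'⟩ := U.exists_val_eq (i := i) (by omega) (by change i ≤ α.size; omega)
      have hrel : D.Rel c'.1.1 c.1.1 ↔ D.Rel d'.1.1 d.1.1 := by
        rw [← mem_Des_iff (T := U) (by omega), ← mem_Des_iff (T := rowReading γ) (by omega),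
          hc', hd', hdes]
      have hrow := DescentKind.rel_congr_lt hD hrel
      -- At a rise, the row below `c` is bounded by the row of `i` in the row reading tableau, which
      -- itself rises by at least one. Without a rise, `c` is no higher than the entry `i`.
      by_cases hcc : c'.1.1 < c.1.1
      · have h2 := hrow.mp hcc
        have h3 : c.1.1 - 1 ≤ d'.1.1 := ih ⟨_, hm⟩ d' hd' (by omega)
        omega
      · exact ((not_lt.mp hcc).trans (ih c' d' hd' hc'.le)).trans hdd

theorem StdFilling.exists_equiv {α γ : Comp} (hs : α.size = γ.size)
    (U : StdFilling α Comp.empty) (V : StdFilling γ Comp.empty) :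
    ∃ e : {c // c ∈ cells α Comp.empty} ≃ {c // c ∈ cells γ Comp.empty},
      ∀ c, (V (e c)).1 = (U c).1 := by
  obtain ⟨n, a⟩ := α
  obtain ⟨m, b⟩ := γ
  obtain rfl : n = m := hs
  exact ⟨U.trans V.symm, fun c => congrArg Subtype.val (V.apply_symm_apply (U c))⟩

/-- Row lengths written as sums over cells can be transported along a bijection of cells that
preserves rows. -/
theorem sum_cells_boole (α : Comp) (r : ℕ) :
    (∑ c : {c // c ∈ cells α Comp.empty}, if c.1.1 = r then 1 else 0) = α.part r := by
  rw [Finset.sum_coe_sort (cells α Comp.empty) (fun c => if c.1 = r then 1 else 0),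
    Finset.sum_boole, Nat.cast_id]
  have : (cells α Comp.empty).filter (fun c => c.1 = r) =
      (Finset.range (α.part r)).image (Prod.mk r) := by
    ext ⟨s, j⟩
    simp only [Finset.mem_filter, mem_cells_empty, Finset.mem_image, Finset.mem_range,
      Prod.mk.injEq]
    constructor
    · rintro ⟨h, rfl⟩
      exact ⟨j, h, rfl, rfl⟩
    · rintro ⟨k, h, rfl, rfl⟩
      exact ⟨h, rfl⟩
  rw [this, Finset.card_image_of_injective _ (Prod.mk_right_injective r), Finset.card_range]

/-- The sum of the row indices of all cells of the diagram of `α`. -/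
def rowWeight (α : Comp) : ℕ := ∑ c : {c // c ∈ cells α Comp.empty}, c.1.1

/-- Matching equal entries, each cell of `α` goes to a cell of `γ` in a weakly higher row. If the
weights agree, all rows agree, and so do the row lengths. -/
theorem eq_or_rowWeight_lt {D : DescentKind}
    (hD : D = DescentKind.dualImmaculate ∨ D = DescentKind.rowStrictDualImmaculate)
    {C : Set ℕ} (hC : 0 ∈ C) {α γ : Comp} (hs : α.size = γ.size) {U : StdFilling α Comp.empty}
    (hU : U ∈ ST C α Comp.empty) (hdes : Des D U = Des D (rowReading γ)) :
    α = γ ∨ rowWeight α < rowWeight γ := by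
  obtain ⟨e, he⟩ := StdFilling.exists_equiv hs U (rowReading γ)
  have hle : ∀ c ∈ Finset.univ, c.1.1 ≤ (e c).1.1 := fun c _ =>
    row_le_row_rowReading hD hC hs hU hdes _ c (e c) (he c) le_rfl
  have hγ : rowWeight γ = ∑ c, (e c).1.1 := (Equiv.sum_comp e fun c => c.1.1).symm
  rcases (Finset.sum_le_sum hle).eq_or_lt with h | h
  · left
    have heq := (Finset.sum_eq_sum_iff_of_le hle).mp h
    refine Comp.ext_part fun r => ?_
    rw [← sum_cells_boole, ← sum_cells_boole, ← Equiv.sum_comp e]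
    exact Finset.sum_congr rfl fun c hc => by rw [heq c hc]
  · right
    rwa [hγ]

theorem linearIndependent_Sk {D : DescentKind}
    (hD : D = DescentKind.dualImmaculate ∨ D = DescentKind.rowStrictDualImmaculate)
    {C : Set ℕ} (hC : 0 ∈ C) : LinearIndependent ℚ (Sk D C) := by
  classical
  -- The multiplicities of the fundamental functions; since these are independent, it suffices that
  -- the vectors of multiplicities are.
  let v : Comp → Comp →₀ ℚ := fun α =>
    ∑ U ∈ ST C α Comp.empty, Finsupp.single (Comp.ofSet α.size (Des D U)) 1
  have hv : LinearIndependent ℚ v := by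
    have hval : ∀ α δ : Comp, Finsupp.lapply (R := ℚ) δ (v α) = (((ST C α Comp.empty).filter
        fun U => Comp.ofSet α.size (Des D U) = δ).card : ℚ) := fun α δ => by
      simp only [v, Finsupp.lapply_apply, Finsupp.finsetSum_apply, Finsupp.single_apply,
        Finset.sum_boole]
    refine linearIndependent_of_triangular v rowWeight
      (fun γ => Finsupp.lapply (Comp.ofSet γ.size (Des D (rowReading γ)))) (fun γ => ?_)
      fun γ α h => ?_
    · rw [hval, Nat.cast_ne_zero]
      exact Finset.card_ne_zero_of_mem
        (Finset.mem_filter.mpr ⟨rowReading_mem_ST C γ, rfl⟩)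
    · rw [hval, Nat.cast_ne_zero, Finset.card_ne_zero] at h
      obtain ⟨U, hU⟩ := h
      obtain ⟨hU, h⟩ := Finset.mem_filter.mp hU
      obtain ⟨hs, hdes⟩ := Comp.ofSet_inj (m := α.size) (n := γ.size)
        (fun i hi => mem_Des_bounds (T := U) hi)
        (fun i hi => mem_Des_bounds (T := rowReading γ) hi) h
      exact eq_or_rowWeight_lt hD hC hs hU hdes
  have hcomp : Sk D C = Finsupp.linearCombination ℚ F ∘ v := by
    funext α
    simp only [Function.comp_apply, v, map_sum, Finsupp.linearCombination_single, one_smul]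
    rfl
  rw [hcomp]
  exact hv.map' _ (linearIndependent_iff_ker.mp linearIndependent_F)

/-! ### Uniqueness -/

/-- Applying to the left tensor factor a functional that vanishes on the span but not at `β` turns
the equation into one that determines a nonzero multiple of `S β`. -/
theorem IsSkewFamily.unique {Sk : Comp → QSym} {α β : Comp} {S S' : Comp → QSym}
    (hS : IsSkewFamily Sk α S) (hS' : IsSkewFamily Sk α S') (hβ : β.Contained α)
    (hspan : Sk β ∉ Submodule.span ℚ (Sk '' {δ | δ.Contained α ∧ δ ≠ β})) : S β = S' β := by
  obtain ⟨f, hf, hker⟩ := Submodule.exists_le_ker_of_notMem hspan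
  have key : ∀ {S : Comp → QSym}, IsSkewFamily Sk α S →
      TensorProduct.lid ℚ QSym (f.rTensor QSym (Δ (Sk α))) = f (Sk β) • S β := by
    intro S h
    rw [show Δ (Sk α) = _ from h]
    simp only [map_sum, LinearMap.rTensor_tmul, TensorProduct.lid_tmul]
    refine Finset.sum_eq_single β (fun δ hδ hne => ?_) fun h => ?_
    · have : Sk δ ∈ f.ker := hker (Submodule.subset_span
        ⟨δ, ⟨(Comp.mem_below.mp hδ).1, hne⟩, rfl⟩)
      rw [LinearMap.mem_ker.mp this, zero_smul]
    · exact absurd (Comp.mem_below.mpr ⟨hβ, hβ.size_le⟩) h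
  exact smul_right_injective _ hf ((key hS).symm.trans (key hS'))

/-- If `βᵢ < βⱼ` with `i < j`, the first cell of row `i` outside `β` belongs to `α` and lies below a
cell of `β`, which contradicts justification. -/
theorem isPartition_of_justified {C : Set ℕ} {α β : Comp} (hC : ∀ i j, j < α.part i → j ∈ C)
    (hβ : ∀ i < β.len, β.part i < α.part i) (hJ : Justified C α β) : β.IsPartition := by
  refine List.pairwise_iff_getElem.mpr fun i j hi hj hij => ?_
  rw [← Comp.part_of_lt hi, ← Comp.part_of_lt hj]
  by_contra h
  have hlt := hβ i hi
  exact lt_irrefl _ (hJ j i (β.part i) (hC i _ hlt) hij (not_le.mp h) hlt)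

end QSymSkew

end

open QSymSkew
open Classical in
theorem proposition6p1 (D : DescentKind) (C : Set ℕ) (hC : 0 ∈ C) (α : Comp) :
    -- the tableau sums satisfy the equation that defines the skew functions
    IsSkewFamily (Sk D C) α
      (fun β => if Justified C α β then tableauSum D C α β else 0) ∧
    -- they are the skew functions, wherever the defining equation determines these
    (∀ S : Comp → QSym, IsSkewFamily (Sk D C) α S →
      ∀ β : Comp, β.Contained α →
        (D = DescentKind.dualImmaculate ∨ D = DescentKind.rowStrictDualImmaculate ∨
          Sk D C β ∉ Submodule.span ℚ (Sk D C '' {δ | δ.Contained α ∧ δ ≠ β})) →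
        (Justified C α β → S β = tableauSum D C α β) ∧ (S β ≠ 0 → Justified C α β)) ∧
    -- contributing shapes are bottom-justified in the increasing columns
    (∀ β : Comp, β.Contained α → Occurs C α β → Justified C α β) ∧
    -- if every column increases and no row of `α / β` is empty, then `β` is a partition
    ((∀ i j, j < α.part i → j ∈ C) →
      ∀ β : Comp, β.Contained α → (∀ i < β.len, β.part i < α.part i) →
        Justified C α β → β.IsPartition) := by
  refine ⟨isSkewFamily_tableauSum D hC α, fun S hS β hβ h => ?_, fun β hβ hocc => ?_,
    fun hall β _ hlt hJ => isPartition_of_justified hall hlt hJ⟩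
  · have hspan : Sk D C β ∉ Submodule.span ℚ (Sk D C '' {δ | δ.Contained α ∧ δ ≠ β}) := by
      -- For the first two descent sets the span condition follows from linear independence;
      -- otherwise it is assumed.
      rcases or_assoc.mpr h with hD | h
      · exact (linearIndependent_Sk hD hC).notMem_span_image fun hmem => hmem.2 rfl
      · exact h
    have heq := hS.unique (isSkewFamily_tableauSum D hC α) hβ hspan
    refine ⟨fun hJ => heq.trans (if_pos hJ), fun hne => ?_⟩
    by_contra hJ
    exact hne (heq.trans (if_neg hJ))
  · obtain ⟨U, hU, hs⟩ := hocc
    exact justified_of_hasShape hβ hU hs
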